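/- Let $$ \mathcal D=\quad \begin{array}{ccc} A' & \xrightarrow{\;v\;} & A\\ {\scriptstyle u'}\downarrow & \alpha & \downarrow{\scriptstyle u}\\ B' & \xrightarrow{\;w\;} & B \end{array} \qquad \alpha: u v\Rightarrow w u' $$ be a square in $\mathrm{Cat}$: four small categories, four functors, and a natural transformation $\alpha$ (not assumed invertible). A square of (not necessarily small) categories of this shape is called *Guitart exact* if for every object $a$ of $A$, every object $b'$ of $B'$ and every arrow $g:u(a)\to w(b')$ of $B$, the following category is connected (in particular non-empty): its objects are the triples $(a',\,f:a\to v(a'),\,g':u'(a')\to b')$, with $a'$ an object of $A'$, such that $w(g')\circ\alpha_{a'}\circ u(f)=g$; a morphism $(a'_1,f_1,g'_1)\to(a'_2,f_2,g'_2)$ is an arrow $h:a'_1\to a'_2$ of $A'$ such that $v(h)f_1=f_2$ and $g'_2u'(h)=g'_1$. For a category $\mathcal C$, let $\underline{\mathrm{Hom}}(\mathcal D^{\mathrm{op}},\mathcal C)$ be the square $$ \begin{array}{ccc} \underline{\mathrm{Hom}}(B^{\mathrm{op}},\mathcal C) & \xrightarrow{\;w^*\;} & \underline{\mathrm{Hom}}(B'^{\mathrm{op}},\mathcal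 C)\\ {\scriptstyle u^*}\downarrow & \alpha^* & \downarrow{\scriptstyle u'^*}\\ \underline{\mathrm{Hom}}(A^{\mathrm{op}},\mathcal C) & \xrightarrow{\;v^*\;} & \underline{\mathrm{Hom}}(A'^{\mathrm{op}},\mathcal C) \end{array} \qquad \alpha^*: u'^*w^*\Rightarrow v^*u^* $$ of categories of $\mathcal C$-valued presheaves, where $u^*,v^*,w^*,u'^*$ are given by precomposition and $(\alpha^*_F)_{a'}=F(\alpha_{a'}):F(wu'(a'))\to F(uv(a'))$. Then the following conditions are equivalent: a) $\mathcal D$ is Guitart exact; b) the square $\underline{\mathrm{Hom}}(\mathcal D^{\mathrm{op}},\mathrm{Set})$ of categories of presheaves of sets is Guitart exact; c) for every category $\mathcal C$ which is complete (has all small limits) or cocomplete (has all small colimits), the square $\underline{\mathrm{Hom}}(\mathcal D^{\mathrm{op}},\mathcal C)$ is Guitart exact; d) there exists a category $\mathcal C$, complete or cocomplete, which is not a preorder (i.e. some two objects of $\mathcal C$ have two distinct parallel morphisms between them), such that $\underline{\mathrm{Hom}}(\mathcal D^{\mathrm{op}},\mathcal C)$ is Guitart exact. -/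

import Mathlib

open CategoryTheory

universe v w u

/-- The category of presheaves on `A` with values in `C`. -/
abbrev PresheafCat (A : Type*) [Category* A] (C : Type*) [Category* C] := Aᵒᵖ ⥤ C

/-- Inverse image of `C`-valued presheaves along `f : A ⥤ B`, that is `F ↦ f.op ⋙ F`. -/
abbrev presheafInverseImage {A B : Type*} [Category* A] [Category* B] (f : A ⥤ B)
    (C : Type*) [Category* C] : PresheafCat B C ⥤ PresheafCat A C :=
  (Functor.whiskeringLeft Aᵒᵖ Bᵒᵖ C).obj f.op

/-- A square
```
      p
  A' ---> A
  |       |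
q |   α   | r        α : r ∘ p ⟶ s ∘ q
  v       v
  B' ---> B
      s
```
induces the square of categories of `C`-valued presheaves
```
        s*
  C^(B) ---> C^(B')
    |          |
 r* |    α*    | q*        α* : q* ∘ s* ⟶ p* ∘ r*
    v          v
  C^(A) ---> C^(A')
        p*
```
where, for a presheaf `F` on `B` and an object `X` of `A'`, the component of `α*` is
`F (α X) : F (s (q X)) ⟶ F (r (p X))`. -/
def presheafSquare {A' A B' B : Type*} [Category* A'] [Category* A] [Category* B'] [Category* B]
    {p : A' ⥤ A} {q : A' ⥤ B'} {r : A ⥤ B} {s : B' ⥤ B} (α : TwoSquare p q r s)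
    (C : Type*) [Category* C] :
    TwoSquare (presheafInverseImage s C) (presheafInverseImage r C)
      (presheafInverseImage q C) (presheafInverseImage p C) :=
  TwoSquare.mk _ _ _ _
    { app := fun F =>
        { app := fun X => F.map (α.app X.unop).op
          naturality := fun X Y f => by
            have h := α.natTrans.naturality f.unop
            dsimp at h ⊢
            rw [← F.map_comp, ← F.map_comp, ← op_comp]
            erw [← op_comp]
            exact congrArg (fun t => F.map t.op) h.symm }
      naturality := fun F G φ => by
        ext X
        exact (φ.naturality (α.app X.unop).op).symm }

open Limits Functor

/-! For cocomplete `C`, the left extensions of a presheaf along `s.op` have an initial object, the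
left Kan extension. Exactness of the presheaf square thus means base change: restriction along `r`
turns left Kan extensions along `s.op` into left Kan extensions along `p.op`. If `α` is exact, the
pointwise formula gives this. Conversely, on copowers of representables base change says that
compatible families of arrows `x ⟶ y` indexed by triples correspond to families indexed by `r.obj a
⟶ s.obj b'`. Two distinct arrows `x ⟶ y` then detect that the triples over each `g` form a connected
category. Complete `C` reduces to this by passing to opposites. -/

lemma initial_of_isInitial_obj {C D : Type*} [Category* C] [Category* D] (F : C ⥤ D) {c : C}
    (hc : IsInitial c) (hF : IsInitial (F.obj c)) : F.Initial := by
  have : (fromPUnit.{0} c).Initial := initial_fromPUnit_of_isInitial hc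
  have : (fromPUnit.{0} (F.obj c)).Initial := initial_fromPUnit_of_isInitial hF
  have : (fromPUnit.{0} c ⋙ F).Initial := initial_of_natIso (F := fromPUnit.{0} (F.obj c))
    (NatIso.ofComponents (fun _ ↦ Iso.refl _))
  exact initial_of_initial_comp (fromPUnit.{0} c) F

/-- Each `k` over `d` yields an arrow `F.obj c ⟶ d`, unchanged along zigzags, hence independent of
`k` by connectedness. Taking for `k` a given `g` itself proves uniqueness. -/
lemma isInitial_obj_of_initial {C D : Type*} [Category* C] [Category* D] (F : C ⥤ D) {c : C}
    (hc : IsInitial c) [F.Initial] : Nonempty (IsInitial (F.obj c)) := by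
  have key (d : D) (k : CostructuredArrow F d) (g : F.obj c ⟶ d)
      (h : F.map (hc.to k.left) ≫ k.hom = g) (k' : CostructuredArrow F d) :
      F.map (hc.to k'.left) ≫ k'.hom = g := by
    refine induct_on_objects {k : CostructuredArrow F d | F.map (hc.to k.left) ≫ k.hom = g}
      (j₀ := k) h ?_ k'
    intro k₁ k₂ f
    have := CostructuredArrow.w f
    simp only [Set.mem_ofPred_eq]
    rw [← this, ← F.map_comp_assoc, hc.hom_ext (hc.to k₁.left ≫ f.left) (hc.to k₂.left)]
  refine ⟨IsInitial.ofUniqueHom (fun d ↦ F.map (hc.to _) ≫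
    (Classical.arbitrary (CostructuredArrow F d)).hom) fun d g ↦ ?_⟩
  refine (key d (CostructuredArrow.mk g) g ?_ _).symm
  change F.map (hc.to c) ≫ g = g
  rw [hc.hom_ext (hc.to c) (𝟙 c), F.map_id, Category.id_comp]

section

variable {A' A B' B : Type*} [Category* A'] [Category* A] [Category* B'] [Category* B]
  {p : A' ⥤ A} {q : A' ⥤ B'} {r : A ⥤ B} {s : B' ⥤ B} (α : TwoSquare p q r s)
  (C : Type*) [Category* C]

open TwoSquare in
/-- Passing to opposite categories exchanges complete and cocomplete coefficients. -/
lemma presheafSquare_guitartExact_op_iff :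
    (presheafSquare α.op Cᵒᵖ).GuitartExact ↔ (presheafSquare α C).GuitartExact := by
  rw [← TwoSquare.guitartExact_op_iff (presheafSquare α C)]
  -- Pasting with squares along the equivalences `opUnopEquiv` preserves and reflects exactness.
  let w₁ : TwoSquare (presheafInverseImage r C).op (opUnopEquiv Bᵒᵖ C).functor
      (opUnopEquiv Aᵒᵖ C).functor (presheafInverseImage r.op Cᵒᵖ) := 𝟙 _
  let w₂ : (presheafInverseImage q C).op ⋙ (opUnopEquiv A'ᵒᵖ C).functor ≅
    (opUnopEquiv B'ᵒᵖ C).functor ⋙ (presheafInverseImage q.op Cᵒᵖ) := Iso.refl _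
  have h₁ : IsIso w₁.natTrans := inferInstanceAs (IsIso (𝟙 _))
  have : w₁ ≫ᵥ presheafSquare α.op Cᵒᵖ = (presheafSquare α C).op ≫ᵥ w₂.hom :=
    TwoSquare.ext _ _ fun F ↦ (vComp_app ..).trans
      ((congrArg (· ≫ _) (CategoryTheory.Functor.map_id _ _)).trans
        ((Category.id_comp _).trans ((Category.comp_id _).symm.trans
          (vComp_app (presheafSquare α C).op w₂.hom F).symm)))
  rw [← GuitartExact.vComp_iff_of_equivalences _ _ _ w₂,
    ← GuitartExact.vComp_iff_of_essSurj w₁]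
  exact iff_of_eq (congrArg _ this)

lemma nonempty_iso_compTwoSquare (F : PresheafCat B' C) (E : s.op.LeftExtension F) :
    Nonempty (E.compTwoSquare α.op ≅ ((presheafSquare α C).structuredArrowDownwards F).obj E) := by
  refine ⟨StructuredArrow.isoMk (Iso.refl _) ?_⟩
  ext X
  change (_ ≫ 𝟙 _ ≫ _ ≫ 𝟙 _) ≫ 𝟙 _ = _ ≫ _
  rw [Category.comp_id]
  erw [Category.comp_id, Category.id_comp]
  rfl

end

section

variable {A' A B' B : Type w} [SmallCategory.{w} A'] [SmallCategory.{w} A]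
  [SmallCategory.{w} B'] [SmallCategory.{w} B]
  {p : A' ⥤ A} {q : A' ⥤ B'} {r : A ⥤ B} {s : B' ⥤ B} (α : TwoSquare p q r s)
  (C : Type u) [Category.{v} C] [HasColimitsOfSize.{w, w} C]

lemma presheafSquare_guitartExact_of_hasColimits [α.GuitartExact] :
    (presheafSquare α C).GuitartExact := by
  rw [TwoSquare.guitartExact_iff_initial]
  intro F
  have hE := isPointwiseLeftKanExtensionOfIsLeftKanExtension (F := F) _
    (s.op.leftKanExtensionUnit F)
  exact initial_of_isInitial_obj _ hE.isUniversal
    ((hE.compTwoSquare α.op).isUniversal.ofIso (nonempty_iso_compTwoSquare ..).some)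

/-! ### Copowers of representables and their Kan extensions -/

noncomputable section

variable {C}

/-- The copower of the object `x` by the presheaf represented by `b`. -/
def representableCopower (b : B) (x : C) : PresheafCat B C :=
  yoneda.obj b ⋙ sigmaConst.{w}.obj x

namespace representableCopower

/-- The coproduct injection corresponding to `h`. -/
def ι {b : B} {b' : Bᵒᵖ} (h : b'.unop ⟶ b) (x : C) : x ⟶ (representableCopower b x).obj b' :=
  Sigma.ι (fun _ : b'.unop ⟶ b ↦ x) h

/-- Morphisms from the values of `representableCopower b x` are families of morphisms from `x`. -/
def desc {b : B} {b' : Bᵒᵖ} {x y : C} (φ : (b'.unop ⟶ b) → (x ⟶ y)) :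
    (representableCopower b x).obj b' ⟶ y :=
  Sigma.desc φ

@[simp]
lemma ι_desc {b : B} {b' : Bᵒᵖ} {x y : C} (φ : (b'.unop ⟶ b) → (x ⟶ y)) (h : b'.unop ⟶ b) :
    ι h x ≫ desc φ = φ h :=
  Sigma.ι_desc ..

@[simp]
lemma ι_desc_assoc {b : B} {b' : Bᵒᵖ} {x y z : C} (φ : (b'.unop ⟶ b) → (x ⟶ y))
    (h : b'.unop ⟶ b) (m : y ⟶ z) : ι h x ≫ desc φ ≫ m = φ h ≫ m := by
  rw [← Category.assoc, ι_desc]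

lemma hom_ext {b : B} {b' : Bᵒᵖ} {x y : C} {f g : (representableCopower b x).obj b' ⟶ y}
    (hfg : ∀ h : b'.unop ⟶ b, ι h x ≫ f = ι h x ≫ g) : f = g :=
  Sigma.hom_ext _ _ hfg

@[simp]
lemma ι_map {b : B} {b₁ b₂ : Bᵒᵖ} (h : b₁.unop ⟶ b) (f : b₁ ⟶ b₂) (x : C) :
    ι h x ≫ (representableCopower b x).map f = ι (f.unop ≫ h) x :=
  (Sigma.ι_comp_map' ..).trans (Category.id_comp _)

@[simp]
lemma ι_map_assoc {b : B} {b₁ b₂ : Bᵒᵖ} (h : b₁.unop ⟶ b) (f : b₁ ⟶ b₂) (x : C) {z : C}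
    (m : (representableCopower b x).obj b₂ ⟶ z) :
    ι h x ≫ (representableCopower b x).map f ≫ m = ι (b' := b₂) (f.unop ≫ h) x ≫ m := by
  rw [← Category.assoc, ι_map]

/-- The morphism from `representableCopower b' x` to the restriction of
`representableCopower (s.obj b') x` along `s`. -/
def unit (s : B' ⥤ B) (b' : B') (x : C) :
    representableCopower b' x ⟶ s.op ⋙ representableCopower (s.obj b') x :=
  whiskerRight (yonedaMap s b') (sigmaConst.obj x)

@[simp]
lemma ι_unit_app (s : B' ⥤ B) (b' : B') (x : C) (b : B'ᵒᵖ) (h : b.unop ⟶ b') :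
    ι h x ≫ (unit s b' x).app b = ι (s.map h) x :=
  (Sigma.ι_comp_map' ..).trans (Category.id_comp _)

lemma ι_unit_app_assoc (s : B' ⥤ B) (b' : B') (x : C) (b : B'ᵒᵖ) (h : b.unop ⟶ b') {z : C}
    (m : (representableCopower (s.obj b') x).obj (s.op.obj b) ⟶ z) :
    ι h x ≫ (unit s b' x).app b ≫ m = ι (b' := s.op.obj b) (s.map h) x ≫ m := by
  rw [← ι_unit_app, Category.assoc]

/-- The extension along `s` of a morphism from `representableCopower b' x`. -/
def lift {s : B' ⥤ B} {b' : B'} {x : C} {H : PresheafCat B C}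
    (θ : representableCopower b' x ⟶ s.op ⋙ H) : representableCopower (s.obj b') x ⟶ H where
  app b := desc fun h ↦ ι (𝟙 b') x ≫ θ.app (.op b') ≫ H.map h.op
  naturality b₁ b₂ f := hom_ext fun h ↦ by simp

lemma unit_lift {s : B' ⥤ B} {b' : B'} {x : C} {H : PresheafCat B C}
    (θ : representableCopower b' x ⟶ s.op ⋙ H) :
    unit s b' x ≫ whiskerLeft s.op (lift θ) = θ := by
  ext b
  refine hom_ext fun h ↦ ?_
  have := θ.naturality (Quiver.Hom.op h)
  dsimp [lift] at this ⊢
  rw [ι_unit_app_assoc, ι_desc, ← this, ι_map_assoc]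
  simp

lemma lift_unique {s : B' ⥤ B} {b' : B'} {x : C} {H : PresheafCat B C}
    (τ : representableCopower (s.obj b') x ⟶ H) :
    lift (unit s b' x ≫ whiskerLeft s.op τ) = τ := by
  ext b
  refine hom_ext fun h ↦ ?_
  have := τ.naturality h.op
  dsimp [lift] at this ⊢
  rw [ι_desc, Category.assoc, ι_unit_app_assoc, ← this, ι_map_assoc]
  simp

/-- `representableCopower (s.obj b') x` is a left Kan extension of `representableCopower b' x`. -/
def isUniversalUnit (s : B' ⥤ B) (b' : B') (x : C) :
    (LeftExtension.mk (L := s.op) _ (unit s b' x)).IsUniversal :=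
  IsInitial.ofUniqueHom (fun E ↦ StructuredArrow.homMk (lift E.hom) (unit_lift E.hom))
    (fun _ m ↦ StructuredArrow.hom_ext _ _
      ((lift_unique m.right).symm.trans (congrArg lift (StructuredArrow.w m))))

end representableCopower

end

open representableCopower in
-- Base change applied to the universal extension `unit`. The formula for `β` records that a triple
-- acts through its composite `r.obj a ⟶ s.obj b'`.
lemma exists_isLeftKanExtension [hα : (presheafSquare α C).GuitartExact] (b' : B') (x : C) :
    ∃ β : q.op ⋙ representableCopower b' x ⟶ p.op ⋙ r.op ⋙ representableCopower (s.obj b') x,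
      IsLeftKanExtension _ β ∧ ∀ (a' : A'ᵒᵖ) (g : q.obj a'.unop ⟶ b'),
        ι (b' := q.op.obj a') g x ≫ β.app a' =
          ι (b' := .op (r.obj (p.obj a'.unop))) (α.app a'.unop ≫ s.map g) x := by
  rw [TwoSquare.guitartExact_iff_initial] at hα
  have := hα (representableCopower b' x)
  let E := (LeftExtension.mk (L := s.op) _ (unit s b' x)).compTwoSquare α.op
  obtain ⟨hE⟩ := isInitial_obj_of_initial ((presheafSquare α C).structuredArrowDownwards _)
    (isUniversalUnit s b' x)
  refine ⟨E.hom, ⟨⟨hE.ofIso (nonempty_iso_compTwoSquare ..).some.symm⟩⟩, fun a' g ↦ ?_⟩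
  have : E.hom.app a' = (unit s b' x).app (q.op.obj a') ≫
      (representableCopower (s.obj b') x).map (α.app a'.unop).op := by
    change _ ≫ 𝟙 _ ≫ _ ≫ 𝟙 _ = _
    erw [Category.comp_id, Category.id_comp]
    rfl
  rw [this, ι_unit_app_assoc]
  exact ι_map ..

open representableCopower in
/-- If the square of presheaf categories is exact, families of morphisms `x ⟶ y` indexed by the
triples `(a', f, g)` and compatible with the morphisms of triples correspond to families indexed
by the morphisms `r.obj a ⟶ s.obj b'`. -/
lemma existsUnique_of_presheafSquare_guitartExact [hα : (presheafSquare α C).GuitartExact]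
    (a : A) (b' : B') (x y : C) (φ : ∀ (a' : A') (_ : a ⟶ p.obj a') (_ : q.obj a' ⟶ b'), x ⟶ y)
    (hφ : ∀ (a₁ a₂ : A') (h : a₁ ⟶ a₂) (f : a ⟶ p.obj a₁) (g : q.obj a₂ ⟶ b'),
      φ a₁ f (q.map h ≫ g) = φ a₂ (f ≫ p.map h) g) :
    ∃! ψ : (r.obj a ⟶ s.obj b') → (x ⟶ y), ∀ (a' : A') (f : a ⟶ p.obj a') (g : q.obj a' ⟶ b'),
      ψ (r.map f ≫ α.app a' ≫ s.map g) = φ a' f g := by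
  obtain ⟨β, _, hβ⟩ := exists_isLeftKanExtension α C b' x
  have hp := isPointwiseLeftKanExtensionOfIsLeftKanExtension _ β (.op a)
  have ι_comp (k : CostructuredArrow p.op (.op a)) (g : q.obj k.left.unop ⟶ b') {z : C}
      (m : (representableCopower (s.obj b') x).obj (.op (r.obj a)) ⟶ z) :
      ι (b' := .op (q.obj k.left.unop)) g x ≫
          CategoryStruct.comp (Z := z) (((LeftExtension.mk _ β).coconeAt (.op a)).ι.app k) m =
        ι (b' := .op (r.obj a)) (r.map k.hom.unop ≫ α.app k.left.unop ≫ s.map g) x ≫ m := by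
    have := hβ k.left g =≫ (representableCopower (s.obj b') x).map (r.map k.hom.unop).op
    rw [ι_map, Category.assoc] at this
    exact (Category.assoc ..).symm.trans (this =≫ m)
  -- A compatible family on triples is a cocone with point `y` on the colimit diagram computing the
  -- Kan extension at `a`.
  let c : Cocone (CostructuredArrow.proj p.op (.op a) ⋙ q.op ⋙ representableCopower b' x) :=
    { pt := y
      ι :=
      { app k := desc fun g ↦ φ k.left.unop k.hom.unop g
        naturality k₁ k₂ f := hom_ext fun g ↦ by
          have : k₂.hom.unop ≫ p.map f.left.unop = k₁.hom.unop :=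
            Quiver.Hom.op_inj (by simpa using CostructuredArrow.w f)
          dsimp
          simp only [ι_map_assoc, ι_desc, Category.comp_id]
          exact (hφ ..).trans (congrArg (fun f' ↦ φ _ f' g) this) } }
  refine ⟨fun g ↦ ι (b' := .op (r.obj a)) g x ≫ hp.desc c, fun a' f g ↦ ?_, fun ψ hψ ↦ ?_⟩
  · let k : CostructuredArrow p.op (.op a) := CostructuredArrow.mk (Y := .op a') (Quiver.Hom.op f)
    exact (ι_comp k g _).symm.trans ((_ ≫= hp.fac c k).trans (ι_desc ..))
  · have : desc (b' := .op (r.obj a)) ψ = hp.desc c := by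
      refine hp.hom_ext fun k ↦ hom_ext fun g ↦ ?_
      rw [hp.fac]
      exact (ι_comp k g _).trans ((ι_desc ..).trans ((hψ ..).trans (ι_desc ..).symm))
    funext g
    rw [← this]
    exact (ι_desc ..).symm

lemma guitartExact_of_presheafSquare_of_hasColimits [(presheafSquare α C).GuitartExact]
    (hC : ¬ Quiver.IsThin C) : α.GuitartExact := by
  classical
  simp only [Quiver.IsThin, not_forall, not_subsingleton_iff_nontrivial] at hC
  obtain ⟨x, y, hxy⟩ := hC
  obtain ⟨t₁, t₂, ht⟩ := exists_pair_ne (x ⟶ y)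
  rw [TwoSquare.guitartExact_iff_isConnected_rightwards]
  intro a b' g
  have hne : Nonempty (α.StructuredArrowRightwards g) := by
    -- With no triple over `g`, the value of `ψ` at `g` is unconstrained, so uniqueness fails.
    by_contra hg
    obtain ⟨ψ, -, hψ⟩ := existsUnique_of_presheafSquare_guitartExact α C a b' x y
      (fun _ _ _ ↦ t₁) (fun _ _ _ _ _ ↦ rfl)
    have h₁ := hψ (fun _ ↦ t₁) (fun _ _ _ ↦ rfl)
    have h₂ := hψ (fun g' ↦ if g' = g then t₂ else t₁) fun a' f k ↦
      if_neg fun h ↦ hg ⟨.mk _ _ a' f k h⟩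
    exact ht (by simpa using congrFun (h₁.trans h₂.symm) g)
  have ⟨k₀⟩ := hne
  refine IsConnected.of_induct (j₀ := k₀) fun S h₀ hS k ↦ ?_
  -- The indicator of `S`, extended by `t₁` to triples not over `g`, is compatible. It factors
  -- through `ψ`, so it is constant over `g`, and `k₀` lies in `S`.
  obtain ⟨ψ, hψ, -⟩ := existsUnique_of_presheafSquare_guitartExact α C a b' x y
    (fun a' f k ↦ if ∃ h, TwoSquare.StructuredArrowRightwards.mk α g a' f k h ∈ S then t₂ else t₁)
    (fun a₁ a₂ h f k ↦ by
      refine if_congr (?_ : (_ : Prop) ↔ _) rfl rfl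
      have comm : r.map f ≫ α.app a₁ ≫ s.map (q.map h ≫ k) =
          r.map (f ≫ p.map h) ≫ α.app a₂ ≫ s.map k := by
        have := α.natTrans.naturality h
        dsimp at this
        simp [reassoc_of% this]
      have (h₁) (h₂) : TwoSquare.StructuredArrowRightwards.mk α g a₁ f (q.map h ≫ k) h₁ ∈ S ↔
          TwoSquare.StructuredArrowRightwards.mk α g a₂ (f ≫ p.map h) k h₂ ∈ S :=
        hS (StructuredArrow.homMk (CostructuredArrow.homMk h rfl) (by ext; rfl))
      exact ⟨fun ⟨h₁, hm⟩ ↦ ⟨comm ▸ h₁, (this _ _).1 hm⟩,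
        fun ⟨h₁, hm⟩ ↦ ⟨comm ▸ h₁, (this _ _).2 hm⟩⟩)
  obtain ⟨a₀, f₀, l₀, rfl, rfl⟩ := k₀.mk_surjective
  obtain ⟨a₁, f₁, l₁, h₁, rfl⟩ := k.mk_surjective
  have h₂ := hψ a₀ f₀ l₀
  rw [if_pos ⟨rfl, h₀⟩, ← h₁, hψ] at h₂
  by_contra hk
  rw [if_neg (fun ⟨_, h⟩ ↦ hk h)] at h₂
  exact ht h₂

lemma presheafSquare_guitartExact_of_hasLimits {D : Type u} [Category.{v} D]
    [HasLimitsOfSize.{w, w} D] [α.GuitartExact] : (presheafSquare α D).GuitartExact := by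
  rw [← presheafSquare_guitartExact_op_iff]
  exact presheafSquare_guitartExact_of_hasColimits _ _

lemma guitartExact_of_presheafSquare_of_hasLimits {D : Type u} [Category.{v} D]
    [HasLimitsOfSize.{w, w} D] [(presheafSquare α D).GuitartExact]
    (hD : ¬ Quiver.IsThin D) : α.GuitartExact := by
  have := (presheafSquare_guitartExact_op_iff α D).2 inferInstance
  rw [← TwoSquare.guitartExact_op_iff]
  exact guitartExact_of_presheafSquare_of_hasColimits α.op Dᵒᵖ fun h ↦
    hD fun X Y ↦ ⟨fun f g ↦ Quiver.Hom.op_inj ((h (.op Y) (.op X)).elim _ _)⟩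

end

lemma not_isThin_type : ¬ Quiver.IsThin (Type w) := fun h ↦ by
  have := congrArg (fun f ↦ (f ⟨⟩).down) ((h PUnit (ULift Bool)).elim
    (↾fun _ ↦ ⟨true⟩) (↾fun _ ↦ ⟨false⟩))
  simp at this

theorem mainTheorem11 {A' A B' B : Type w} [SmallCategory.{w} A'] [SmallCategory.{w} A]
    [SmallCategory.{w} B'] [SmallCategory.{w} B]
    {p : A' ⥤ A} {q : A' ⥤ B'} {r : A ⥤ B} {s : B' ⥤ B} (α : TwoSquare p q r s) :
    List.TFAE [
      α.GuitartExact,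
      (presheafSquare α (Type w)).GuitartExact,
      ∀ (C : Type (max u (w + 1))) [Category.{max v w} C],
        (Limits.HasLimitsOfSize.{w, w} C ∨ Limits.HasColimitsOfSize.{w, w} C) →
          (presheafSquare α C).GuitartExact,
      ∃ (C : Type (max u (w + 1))) (_ : Category.{max v w} C),
        (Limits.HasLimitsOfSize.{w, w} C ∨ Limits.HasColimitsOfSize.{w, w} C) ∧
          ¬ Quiver.IsThin C ∧ (presheafSquare α C).GuitartExact] := by
  tfae_have 1 → 2 := fun _ ↦ presheafSquare_guitartExact_of_hasColimits α (Type w)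
  tfae_have 2 → 1 := fun _ ↦
    guitartExact_of_presheafSquare_of_hasColimits α (Type w) not_isThin_type
  tfae_have 1 → 3 := fun _ C _ hC ↦ hC.elim
    (fun _ ↦ presheafSquare_guitartExact_of_hasLimits α)
    (fun _ ↦ presheafSquare_guitartExact_of_hasColimits α C)
  tfae_have 3 → 4 := fun h ↦ by
    -- The witness is `Type w`, lifted to the required universes.
    let _ : Category.{w} (ULift.{u} (Type w)) := uliftCategory _
    let e : Type w ≌ ULiftHom.{max v w} (ULift.{u} (Type w)) := ULiftHomULiftCategory.equiv _
    have := Adjunction.has_colimits_of_equivalence.{w, w} e.inverse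
    exact ⟨_, inferInstance, .inr this, fun hC ↦ not_isThin_type fun X Y ↦
      ⟨fun f g ↦ e.functor.map_injective ((hC _ _).elim _ _)⟩, h _ (.inr this)⟩
  tfae_have 4 → 1 := fun ⟨C, _, hC, hC', _⟩ ↦ hC.elim
    (fun _ ↦ guitartExact_of_presheafSquare_of_hasLimits α hC')
    (fun _ ↦ guitartExact_of_presheafSquare_of_hasColimits α C hC')
  tfae_finish
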